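/- Let $K$ be a compact metrizable space and let $C(K)$ be the Banach space of real-valued continuous functions on $K$ with the supremum norm. For a sequence $g=(g_n)_{n\in\mathbb N}$ in $C(K)$ put $$\mathcal B(g)=\Big\{M\subseteq\mathbb N:\ \sup_{F\subseteq M\text{ finite}}\Big\|\sum_{n\in F}g_n\Big\|<\infty\Big\},$$ and call $g$ weakly null if $\varphi(g_n)\to0$ for every continuous linear functional $\varphi$ on $C(K)$. A family $\mathcal I$ of subsets of $\mathbb N$ is tall if every infinite subset of $\mathbb N$ contains an infinite member of $\mathcal I$; $\mathrm{Fin}$ is the family of finite subsets of $\mathbb N$; $\mathcal I\le_K\mathcal J$ (Katětov order) means that there is $f:\mathbb N\to\mathbb N$ with $f^{-1}(A)\in\mathcal J$ for all $A\in\mathcal I$; and $\mathcal R$ is the ideal on $\mathbb N$ generated by the cliques and the independent sets of the random (Rado) graph on $\mathbb N$. We say that $K$ has finite Cantor–Bendixson rank if $K^{(n)}=\emptyset$ for some $n\in\mathbb N$, where $K^{(0)}=K$ and $K^{(n+1)}$ is the set of non-isolated points of $K^{(n)}$. Then the following are equivalent: (i) $\mathcal B(g)$ is tall for every weakly null sequence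 $g$ in $C(K)$; (ii) $\mathrm{Fin}\subsetneq\mathcal B(g)$ for every weakly null sequence $g$ in $C(K)$; (iii) $\mathcal R\le_K\mathcal B(g)$ for every weakly null sequence $g$ in $C(K)$; (iv) $K$ has finite Cantor–Bendixson rank; (v) $C(K)$ is finite-dimensional or linearly homeomorphic to $c_0$. -/

import Mathlib

open Filter Topology TopologicalSpace ZeroAtInfty

namespace BIdeal

/-- A family of subsets of `ℕ` is tall when every infinite set contains an infinite member. -/
def Tall (I : Set (Set ℕ)) : Prop :=
  ∀ A : Set ℕ, A.Infinite → ∃ B : Set ℕ, B ⊆ A ∧ B.Infinite ∧ B ∈ I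

/-- The Fréchet ideal `Fin` of finite subsets of `ℕ`. -/
def finIdeal : Set (Set ℕ) := {A | A.Finite}

/-- The Katětov pre-order. -/
def KatetovLE (I J : Set (Set ℕ)) : Prop :=
  ∃ f : ℕ → ℕ, ∀ A ∈ I, f ⁻¹' A ∈ J

/-- The random (Rado) graph: `m` and `n` are joined when the `m`-th binary digit of `n` or the
`n`-th binary digit of `m` is one. -/
def randomGraph : SimpleGraph ℕ where
  Adj m n := n.testBit m = true ∨ m.testBit n = true
  symm := ⟨fun _ _ h => h.symm⟩
  loopless := ⟨fun n h => by simp [Nat.testBit_eq_false_of_lt Nat.lt_two_pow_self] at h⟩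

/-- The extension property, which characterizes the random graph up to isomorphism among the
countable graphs. -/
theorem randomGraph_extension (U V : Finset ℕ) (h : Disjoint U V) :
    ∃ z : ℕ, z ∉ U ∧ z ∉ V ∧ (∀ u ∈ U, randomGraph.Adj z u) ∧
      ∀ v ∈ V, ¬ randomGraph.Adj z v := by
  have bits : ∀ S : Finset ℕ, ∃ z : ℕ, ∀ i, z.testBit i = true ↔ i ∈ S := by
    intro S
    induction S using Finset.induction_on with
    | empty => exact ⟨0, by simp⟩
    | insert a S _ ih =>
      obtain ⟨z, hz⟩ := ih
      refine ⟨z ||| 2 ^ a, fun i => ?_⟩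
      simp only [Nat.testBit_or, Nat.testBit_two_pow, Bool.or_eq_true, hz, decide_eq_true_eq,
        Finset.mem_insert]
      tauto
  obtain ⟨N, hN⟩ : ∃ N : ℕ, ∀ i ∈ U ∪ V, i < N :=
    ⟨(U ∪ V).sup id + 1, fun i hi => Nat.lt_succ_of_le (Finset.le_sup (f := id) hi)⟩
  obtain ⟨z, hz⟩ := bits (insert N U)
  have hNz : N < z := by
    have h1 : 2 ^ N ≤ z := Nat.ge_two_pow_of_testBit ((hz N).2 (Finset.mem_insert_self N U))
    exact lt_of_lt_of_le Nat.lt_two_pow_self h1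
  have hlt : ∀ i ∈ U ∪ V, i < z := fun i hi => (hN i hi).trans hNz
  refine ⟨z, fun hU => ?_, fun hV => ?_, fun u hu => Or.inr ?_, fun v hv hadj => ?_⟩
  · exact lt_irrefl _ (hlt z (Finset.mem_union_left _ hU))
  · exact lt_irrefl _ (hlt z (Finset.mem_union_right _ hV))
  · exact (hz u).2 (Finset.mem_insert_of_mem hu)
  · have hvz := hlt v (Finset.mem_union_right _ hv)
    rcases hadj with h1 | h1
    · rw [Nat.testBit_eq_false_of_lt (hvz.trans Nat.lt_two_pow_self)] at h1
      exact Bool.false_ne_true h1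
    · rcases Finset.mem_insert.1 ((hz v).1 h1) with h2 | h2
      · exact absurd h2 (hN v (Finset.mem_union_right _ hv)).ne
      · exact (Finset.disjoint_left.1 h h2) hv

/-- The random ideal `ℛ`: the ideal on `ℕ` generated by the cliques and the independent sets of
the random graph. -/
def randomIdeal : Set (Set ℕ) :=
  {A | ∃ S : Set (Set ℕ), S.Finite ∧
    (∀ H ∈ S, randomGraph.IsClique H ∨ randomGraph.IsIndepSet H) ∧ A ⊆ ⋃₀ S}

/-- The family `ℬ(x)` of all `M ⊆ ℕ` such that the norms of the sums `∑ n ∈ F, x n`, over the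
finite sets `F ⊆ M`, are bounded. -/
def boundedIdeal {X : Type*} [SeminormedAddCommGroup X] (x : ℕ → X) : Set (Set ℕ) :=
  {M | ∃ C : ℝ, ∀ F : Finset ℕ, (F : Set ℕ) ⊆ M → ‖∑ n ∈ F, x n‖ ≤ C}

/-- Weak convergence to zero of a sequence in a normed space. -/
def WeaklyNull {X : Type*} [NormedAddCommGroup X] [NormedSpace ℝ X] (x : ℕ → X) : Prop :=
  ∀ φ : X →L[ℝ] ℝ, Tendsto (fun n => φ (x n)) atTop (𝓝 0)

/-- The Cantor–Bendixson rank is finite: some derivative of finite order is empty. (In particular a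
space with a nonempty perfect kernel does not have finite rank.) -/
def FiniteCBRank (K : Type*) [TopologicalSpace K] : Prop :=
  ∃ n : ℕ, CantorBendixson.iteratedDerivedSet (Set.univ : Set K) (n : Ordinal) = ∅

end BIdeal

namespace BIdeal

/-! ### Ramsey's theorem for pairs -/

/-! The proof runs through the cycle (iii) → (i) → (ii) → (iv) → (v) → (iii). Ramsey's theorem gives
(iii) → (i), and (i) → (ii) is immediate.

(ii) → (iv): if all derivatives of finite order are nonempty, then for each `m` there is a weakly
null sequence of functions into `[0, 1]` whose sums are at most `m`, any `m` of them being one at a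
common point (`exists_isSpread`). Adding these for `m = 4 ^ k` with weights `2 ^ (-k)` gives a
weakly null sequence that is unbounded along every infinite set.

(iv) → (v): `nonempty_zeroAtInfty_equiv_of_derivedSet` splits `C(s)` into `C(s')` and `c₀` of the
isolated points of `s`; finitely many splittings leave `c₀` of a countable set.

(v) → (iii): every graph on `ℕ` is an induced subgraph of the random graph, so a graph whose cliques
and independent sets lie in the ideal suffices. In `c₀`, join `m < n` when `|x n| ≤ 2 ^ (-m)` at
every coordinate where `|x m| ≥ 2 ^ (-m)`. Independent sets are then finite, and sums along cliques
are bounded uniformly in the coordinates (`randomIdeal_katetovLE_of_domination`). -/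

theorem exists_infinite_pairwise_of_eventually {A : Set ℕ} {l : Filter ℕ} [l.NeBot]
    (hl : l ≤ cofinite) (hA : A ∈ l) {r : ℕ → ℕ → Prop} (hr : ∀ x y, r x y → r y x)
    (h : ∀ᶠ x in l, ∀ᶠ y in l, r x y) :
    ∃ B : Set ℕ, B ⊆ A ∧ B.Infinite ∧ B.Pairwise r := by
  have : Std.Symm (fun x y : ℕ => x ≠ y ∧ r x y) := ⟨fun x y h => ⟨h.1.symm, hr _ _ h.2⟩⟩
  -- Greedy choice: finitely many earlier points impose finitely many conditions, each holding on a
  -- set of `l`.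
  obtain ⟨f, hf, hp⟩ := exists_seq_of_forall_finset_exists'
    (fun x : ℕ => x ∈ A ∧ ∀ᶠ y in l, r x y) (fun x y => x ≠ y ∧ r x y) (by
      intro s hs
      have h1 : ∀ᶠ y in l, ∀ x ∈ s, x ≠ y ∧ r x y := by
        rw [Finset.eventually_all]
        intro x hx
        refine Filter.Eventually.and ?_ (hs x hx).2
        exact hl ((Set.finite_singleton x).subset fun y hy => by
          simpa [eq_comm] using hy)
      obtain ⟨y, h2, h3, h4⟩ := (h1.and ((eventually_mem_set.2 hA).and h)).exists
      exact ⟨y, ⟨h3, h4⟩, h2⟩)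
  have hinj : Function.Injective f := fun i j hij => by
    by_contra hne
    exact (hp hne).1 hij
  refine ⟨Set.range f, ?_, Set.infinite_range_of_injective hinj, ?_⟩
  · rintro _ ⟨i, rfl⟩
    exact (hf i).1
  · rintro _ ⟨i, rfl⟩ _ ⟨j, rfl⟩ hij
    exact (hp (fun h => hij (congrArg f h))).2

/-- A nonprincipal ultrafilter containing `A` decides whether the generic pair is an edge. -/
theorem exists_infinite_isClique_or_isIndepSet (G : SimpleGraph ℕ) {A : Set ℕ}
    (hA : A.Infinite) :
    ∃ B : Set ℕ, B ⊆ A ∧ B.Infinite ∧ (G.IsClique B ∨ G.IsIndepSet B) := by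
  have hne : (cofinite ⊓ 𝓟 A).NeBot := hA.cofinite_inf_principal_neBot
  let U : Ultrafilter ℕ := Ultrafilter.of (cofinite ⊓ 𝓟 A)
  have hU : (U : Filter ℕ) ≤ cofinite ⊓ 𝓟 A := Ultrafilter.of_le _
  have hU1 := hU.trans inf_le_left
  have hU2 : A ∈ (U : Filter ℕ) := hU (mem_inf_of_right (mem_principal_self A))
  by_cases h : ∀ᶠ x in (U : Filter ℕ), ∀ᶠ y in (U : Filter ℕ), G.Adj x y
  · obtain ⟨B, h1, h2, h3⟩ := exists_infinite_pairwise_of_eventually hU1 hU2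
      (fun x y h => h.symm) h
    exact ⟨B, h1, h2, Or.inl h3⟩
  · rw [← Ultrafilter.eventually_not] at h
    simp only [← Ultrafilter.eventually_not] at h
    obtain ⟨B, h1, h2, h3⟩ := exists_infinite_pairwise_of_eventually hU1 hU2
      (fun x y h h' => h h'.symm) h
    exact ⟨B, h1, h2, Or.inr h3⟩

/-! ### The ideals -/

section Ideal

variable {X : Type*} [SeminormedAddCommGroup X] {x : ℕ → X}

theorem boundedIdeal_mono {M N : Set ℕ} (hN : N ∈ boundedIdeal x) (h : M ⊆ N) :
    M ∈ boundedIdeal x := by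
  obtain ⟨C, hC⟩ := hN
  exact ⟨C, fun F hF => hC F (hF.trans h)⟩

theorem boundedIdeal_union {M N : Set ℕ} (hM : M ∈ boundedIdeal x) (hN : N ∈ boundedIdeal x) :
    M ∪ N ∈ boundedIdeal x := by
  classical
  obtain ⟨C, hC⟩ := hM
  obtain ⟨D, hD⟩ := hN
  refine ⟨C + D, fun F hF => ?_⟩
  rw [← Finset.sum_filter_add_sum_filter_not F (· ∈ M)]
  refine (norm_add_le _ _).trans (add_le_add (hC _ ?_) (hD _ ?_))
  · intro i hi
    exact (Finset.mem_filter.1 hi).2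
  · intro i hi
    have := Finset.mem_filter.1 hi
    exact (hF this.1).resolve_left this.2

theorem finite_mem_boundedIdeal {M : Set ℕ} (hM : M.Finite) : M ∈ boundedIdeal x := by
  refine ⟨∑ n ∈ hM.toFinset, ‖x n‖, fun F hF => (norm_sum_le _ _).trans ?_⟩
  exact Finset.sum_le_sum_of_subset_of_nonneg (fun i hi => hM.mem_toFinset.2 (hF hi))
    fun _ _ _ => norm_nonneg _

theorem sUnion_mem_boundedIdeal {S : Set (Set ℕ)} (hS : S.Finite)
    (h : ∀ H ∈ S, H ∈ boundedIdeal x) : ⋃₀ S ∈ boundedIdeal x := by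
  induction S, hS using Set.Finite.induction_on with
  | empty => simpa using finite_mem_boundedIdeal Set.finite_empty
  | insert _ _ ih =>
    rw [Set.sUnion_insert]
    exact boundedIdeal_union (h _ (Set.mem_insert _ _))
      (ih fun H hH => h H (Set.mem_insert_of_mem _ hH))

theorem finIdeal_ssubset_boundedIdeal_of_tall (h : Tall (boundedIdeal x)) :
    finIdeal ⊂ boundedIdeal x := by
  refine ⟨fun M hM => finite_mem_boundedIdeal hM, fun hsub => ?_⟩
  obtain ⟨B, -, hB, hBx⟩ := h Set.univ Set.infinite_univ
  exact hB (hsub hBx)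

theorem mem_randomIdeal_of_homogeneous {H : Set ℕ}
    (h : randomGraph.IsClique H ∨ randomGraph.IsIndepSet H) : H ∈ randomIdeal :=
  ⟨{H}, Set.finite_singleton H, by simpa using h, by simp⟩

theorem tall_of_randomIdeal_katetovLE (h : KatetovLE randomIdeal (boundedIdeal x)) :
    Tall (boundedIdeal x) := by
  obtain ⟨f, hf⟩ := h
  intro A hA
  -- An infinite fibre is settled by the clique `{k}`; if all fibres in `A` are finite, Ramsey's
  -- theorem applies to `f '' A`.
  by_cases hk : ∃ k, (A ∩ f ⁻¹' {k}).Infinite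
  · obtain ⟨k, hk⟩ := hk
    refine ⟨_, Set.inter_subset_left, hk, boundedIdeal_mono (hf {k} ?_) Set.inter_subset_right⟩
    exact mem_randomIdeal_of_homogeneous (Or.inl (by simp))
  · push Not at hk
    have himg : (f '' A).Infinite := by
      intro hfin
      have hU : (⋃ k ∈ f '' A, A ∩ f ⁻¹' {k}).Finite :=
        hfin.biUnion fun k _ => Set.not_infinite.1 (by simpa using hk k)
      exact hA (hU.subset fun a ha => Set.mem_biUnion (Set.mem_image_of_mem f ha) ⟨ha, rfl⟩)
    obtain ⟨B, hBA, hB, hB'⟩ := exists_infinite_isClique_or_isIndepSet randomGraph himg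
    refine ⟨A ∩ f ⁻¹' B, Set.inter_subset_left, fun hfin => hB ((hfin.image f).subset ?_),
      boundedIdeal_mono (hf B (mem_randomIdeal_of_homogeneous hB')) Set.inter_subset_right⟩
    intro b hb
    obtain ⟨a, ha, rfl⟩ := hBA hb
    exact ⟨a, ⟨ha, hb⟩, rfl⟩

end Ideal

/-! ### Universality of the random graph -/

open Classical in
/-- A greedy embedding of a graph on `ℕ` into the random graph. -/
noncomputable def randomEmbedding (G : SimpleGraph ℕ) (n : ℕ) : ℕ :=
  let U : Finset ℕ := ((Finset.univ : Finset (Fin n)).filter fun i : Fin n => G.Adj n i).image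
    fun i : Fin n => randomEmbedding G i
  let V : Finset ℕ := ((Finset.univ : Finset (Fin n)).filter fun i : Fin n => ¬ G.Adj n i).image
    fun i : Fin n => randomEmbedding G i
  -- Removing `U` makes the two sets disjoint before injectivity is known.
  (randomGraph_extension U (V \ U) Finset.disjoint_sdiff).choose
termination_by n
decreasing_by all_goals exact i.isLt

/-- The extra hypothesis of the last clause undoes the removal of `U`; injectivity, a consequence of
the first clause, discharges it later. -/
theorem randomEmbedding_spec (G : SimpleGraph ℕ) (n : ℕ) :
    (∀ i < n, randomEmbedding G n ≠ randomEmbedding G i) ∧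
    (∀ i < n, G.Adj n i → randomGraph.Adj (randomEmbedding G n) (randomEmbedding G i)) ∧
    (∀ i < n, ¬ G.Adj n i →
      (∀ j < n, G.Adj n j → randomEmbedding G j ≠ randomEmbedding G i) →
      ¬ randomGraph.Adj (randomEmbedding G n) (randomEmbedding G i)) := by
  classical
  let U : Finset ℕ := ((Finset.univ : Finset (Fin n)).filter fun i : Fin n => G.Adj n i).image
    fun i : Fin n => randomEmbedding G i
  let V : Finset ℕ := ((Finset.univ : Finset (Fin n)).filter fun i : Fin n => ¬ G.Adj n i).image
    fun i : Fin n => randomEmbedding G i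
  have hspec := (randomGraph_extension U (V \ U) Finset.disjoint_sdiff).choose_spec
  have heq : randomEmbedding G n =
      (randomGraph_extension U (V \ U) Finset.disjoint_sdiff).choose := by
    rw [randomEmbedding]
  rw [← heq] at hspec
  obtain ⟨h1, h2, h3, h4⟩ := hspec
  have hmemU : ∀ i < n, G.Adj n i → randomEmbedding G i ∈ U := fun i hi hadj =>
    Finset.mem_image.2 ⟨⟨i, hi⟩, by simpa using hadj, rfl⟩
  have hmemV : ∀ i < n, ¬ G.Adj n i → randomEmbedding G i ∈ V := fun i hi hadj =>
    Finset.mem_image.2 ⟨⟨i, hi⟩, by simpa using hadj, rfl⟩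
  refine ⟨fun i hi he => ?_, fun i hi hadj => h3 _ (hmemU i hi hadj),
    fun i hi hadj hne => h4 _ (Finset.mem_sdiff.2 ⟨hmemV i hi hadj, fun hU => ?_⟩)⟩
  · by_cases hadj : G.Adj n i
    · exact h1 (he ▸ hmemU i hi hadj)
    · by_cases hU : randomEmbedding G i ∈ U
      · exact h1 (he ▸ hU)
      · exact h2 (he ▸ Finset.mem_sdiff.2 ⟨hmemV i hi hadj, hU⟩)
  · obtain ⟨j, hj, hji⟩ := Finset.mem_image.1 hU
    exact hne j j.2 (by simpa using hj) hji

theorem randomEmbedding_injective (G : SimpleGraph ℕ) :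
    Function.Injective (randomEmbedding G) := by
  intro m n h
  rcases lt_trichotomy m n with hlt | heq | hlt
  · exact absurd h.symm ((randomEmbedding_spec G n).1 m hlt)
  · exact heq
  · exact absurd h ((randomEmbedding_spec G m).1 n hlt)

theorem randomEmbedding_adj (G : SimpleGraph ℕ) (m n : ℕ) :
    randomGraph.Adj (randomEmbedding G m) (randomEmbedding G n) ↔ G.Adj m n := by
  have key : ∀ m n, n < m →
      (randomGraph.Adj (randomEmbedding G m) (randomEmbedding G n) ↔ G.Adj m n) := by
    intro m n hlt
    obtain ⟨-, h2, h3⟩ := randomEmbedding_spec G m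
    refine ⟨fun h => ?_, h2 n hlt⟩
    by_contra hn
    refine h3 n hlt hn (fun j _ hadj he => hn ?_) h
    exact randomEmbedding_injective G he ▸ hadj
  rcases lt_trichotomy m n with hlt | rfl | hlt
  · rw [SimpleGraph.adj_comm, key n m hlt, SimpleGraph.adj_comm]
  · simp
  · exact key m n hlt

/-! ### A domination criterion for lying above the random ideal -/

section Criterion

variable {X : Type*} [SeminormedAddCommGroup X] {x : ℕ → X}

theorem randomIdeal_katetovLE_of_graph (G : SimpleGraph ℕ)
    (hcl : ∀ H, G.IsClique H → H ∈ boundedIdeal x)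
    (hind : ∀ H, G.IsIndepSet H → H ∈ boundedIdeal x) :
    KatetovLE randomIdeal (boundedIdeal x) := by
  refine ⟨randomEmbedding G, ?_⟩
  rintro A ⟨S, hS, hSH, hA⟩
  refine boundedIdeal_mono (sUnion_mem_boundedIdeal
    (hS.image fun H => randomEmbedding G ⁻¹' H) ?_) (N := _) ?_
  · rintro _ ⟨H, hH, rfl⟩
    rcases hSH H hH with h | h
    · refine hcl _ fun a ha b hb hab => ?_
      exact (randomEmbedding_adj G a b).1
        (h ha hb ((randomEmbedding_injective G).ne hab))
    · refine hind _ fun a ha b hb hab hadj => ?_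
      exact h ha hb ((randomEmbedding_injective G).ne hab)
        ((randomEmbedding_adj G a b).2 hadj)
  · intro n hn
    obtain ⟨H, hH, hnH⟩ := hA hn
    exact ⟨_, ⟨H, hH, rfl⟩, hnH⟩

/-- Each element other than the least is controlled by its predecessor in `F`. The maximum of a set
of size `c` is at least `c - 1`, so the next term is at most `2 * (1 / 2) ^ c`. -/
theorem sum_le_of_pairwise_le {a : ℕ → ℝ} {C : ℝ} (hC : 0 ≤ C) (F : Finset ℕ)
    (haC : ∀ n ∈ F, a n ≤ C) (ha : ∀ m ∈ F, ∀ n ∈ F, m < n → a n ≤ (1 / 2) ^ m) :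
    ∑ n ∈ F, a n ≤ C + 4 := by
  have key : ∑ n ∈ F, a n ≤ C + 2 * ∑ i ∈ Finset.range F.card, (1 / 2 : ℝ) ^ i := by
    induction F using Finset.induction_on_max with
    | empty => simpa using hC
    | insert b F hb ih =>
      have hbF : b ∉ F := fun h => lt_irrefl _ (hb b h)
      rw [Finset.sum_insert hbF, Finset.card_insert_of_notMem hbF]
      rcases F.eq_empty_or_nonempty with rfl | hne
      · have := haC b (Finset.mem_insert_self _ _)
        simp
        linarith
      · have ih' := ih (fun n hn => haC n (Finset.mem_insert_of_mem hn))
          (fun m hm n hn => ha m (Finset.mem_insert_of_mem hm) n (Finset.mem_insert_of_mem hn))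
        have hmax := F.max'_mem hne
        have h1 := ha _ (Finset.mem_insert_of_mem hmax) b (Finset.mem_insert_self _ _) (hb _ hmax)
        have h2 : F.card ≤ F.max' hne + 1 := by
          have : F ⊆ Finset.range (F.max' hne + 1) := fun i hi =>
            Finset.mem_range.2 (Nat.lt_succ_of_le (F.le_max' i hi))
          simpa using Finset.card_le_card this
        have h3 : (1 / 2 : ℝ) ^ (F.max' hne + 1) ≤ (1 / 2) ^ F.card :=
          pow_le_pow_of_le_one (by norm_num) (by norm_num) h2
        rw [pow_succ] at h3
        rw [Finset.sum_range_succ]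
        linarith
  linarith [sum_geometric_two_le F.card]

/-- A sequence whose norms are controlled by a family of nonnegative sequences `a j`, each of which
is dominated by a geometric one up to the first time that `j` enters the sets `S n`. -/
theorem randomIdeal_katetovLE_of_domination {J : Type*} (a : J → ℕ → ℝ) (S : ℕ → Set J) {C : ℝ}
    (hC : 0 ≤ C) (haC : ∀ j n, a j n ≤ C) (hS : ∀ j n, j ∉ S n → a j n ≤ (1 / 2) ^ n)
    (hev : ∀ m, ∀ᶠ n in atTop, ∀ j ∈ S m, a j n ≤ (1 / 2) ^ m)
    (hnorm : ∀ (F : Finset ℕ) (B : ℝ), 0 ≤ B → (∀ j, ∑ n ∈ F, a j n ≤ B) →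
      ‖∑ n ∈ F, x n‖ ≤ B) :
    KatetovLE randomIdeal (boundedIdeal x) := by
  classical
  let r : ℕ → ℕ → Prop := fun m n => m < n ∧ ∀ j ∈ S m, a j n ≤ (1 / 2) ^ m
  refine randomIdeal_katetovLE_of_graph (SimpleGraph.fromRel r) (fun H hH => ?_) fun H hH => ?_
  -- For fixed `j`, the indices with `j ∉ S n` contribute a geometric sum, at most `2`; the others
  -- are pairwise joined and contribute at most `C + 4`.
  · refine ⟨2 + (C + 4), fun F hF => hnorm F _ (by positivity) fun j => ?_⟩
    rw [← Finset.sum_filter_not_add_sum_filter F (fun n => j ∈ S n)]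
    refine add_le_add ?_ (sum_le_of_pairwise_le hC _ (fun n _ => haC j n) ?_)
    · refine (Finset.sum_le_sum fun n hn => hS j n (Finset.mem_filter.1 hn).2).trans ?_
      exact (Summable.sum_le_tsum _ (fun _ _ => by positivity) summable_geometric_two).trans
        tsum_geometric_two.le
    · intro m hm n hn hmn
      obtain ⟨hm1, hm2⟩ := Finset.mem_filter.1 hm
      have hadj := hH (hF hm1) (hF (Finset.mem_filter.1 hn).1) hmn.ne
      rw [SimpleGraph.fromRel_adj] at hadj
      rcases hadj.2 with h | h
      · exact h.2 j hm2
      · exact absurd h.1 hmn.not_gt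
  -- Each `m` is joined to almost all `n`, so independent sets are finite.
  · rcases H.eq_empty_or_nonempty with rfl | ⟨m, hm⟩
    · exact finite_mem_boundedIdeal Set.finite_empty
    · obtain ⟨N, hN⟩ := eventually_atTop.1 (hev m)
      refine finite_mem_boundedIdeal ((Set.finite_Iio (max N (m + 1))).subset fun n hn => ?_)
      by_contra hlt
      have hle : max N (m + 1) ≤ n := not_lt.1 hlt
      have hmn : m < n := (le_max_right _ _).trans hle
      refine hH hm hn hmn.ne ?_
      rw [SimpleGraph.fromRel_adj]
      exact ⟨hmn.ne, Or.inl ⟨hmn, hN n ((le_max_left _ _).trans hle)⟩⟩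

end Criterion

/-! ### Weakly null sequences in `c₀` and in finite-dimensional spaces -/

section Weak

variable {X Y : Type*} [NormedAddCommGroup X] [NormedSpace ℝ X] [NormedAddCommGroup Y]
  [NormedSpace ℝ Y] {x : ℕ → X}

theorem WeaklyNull.map (hx : WeaklyNull x) (T : X →L[ℝ] Y) : WeaklyNull fun n => T (x n) :=
  fun φ => hx (φ.comp T)

theorem WeaklyNull.exists_norm_le (hx : WeaklyNull x) : ∃ C : ℝ, 0 ≤ C ∧ ∀ n, ‖x n‖ ≤ C := by
  obtain ⟨C, hC⟩ := banach_steinhaus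
    (g := fun n => NormedSpace.inclusionInDoubleDual ℝ X (x n)) (fun φ => by
      obtain ⟨C, hC⟩ := (hx φ).norm.bddAbove_range
      exact ⟨C, fun n => hC ⟨n, rfl⟩⟩)
  refine ⟨C, (norm_nonneg _).trans (hC 0), fun n => ?_⟩
  rw [← (NormedSpace.inclusionInDoubleDualLi ℝ).norm_map (x n)]
  exact hC n

theorem boundedIdeal_map_subset (T : X ≃L[ℝ] Y) :
    boundedIdeal (fun n => T (x n)) ⊆ boundedIdeal x := by
  rintro M ⟨C, hC⟩
  refine ⟨‖(T.symm : Y →L[ℝ] X)‖ * C, fun F hF => ?_⟩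
  have h := (T.symm : Y →L[ℝ] X).le_opNorm_of_le (hC F hF)
  simpa [map_sum] using h

theorem randomIdeal_katetovLE_of_finiteDimensional [FiniteDimensional ℝ X] (hx : WeaklyNull x) :
    KatetovLE randomIdeal (boundedIdeal x) := by
  have hlim : Tendsto (fun n => ‖x n‖) atTop (𝓝 0) := by
    let T := (Module.finBasis ℝ X).equivFunL
    have h : Tendsto (fun n => T (x n)) atTop (𝓝 0) := by
      rw [tendsto_pi_nhds]
      intro i
      exact hx ((ContinuousLinearMap.proj (R := ℝ) (φ := fun _ => ℝ) i).comp (T : X →L[ℝ] _))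
    have h2 := (T.symm.continuous.tendsto 0).comp h
    simp only [map_zero] at h2
    have h3 : (⇑T.symm ∘ fun n => T (x n)) = x := by ext n; simp
    rw [h3] at h2
    simpa using h2.norm
  obtain ⟨C, hC, hCx⟩ := hx.exists_norm_le
  refine randomIdeal_katetovLE_of_domination (J := Unit) (fun _ n => ‖x n‖) (fun _ => Set.univ) hC
    (fun _ => hCx) (fun j n h => absurd (Set.mem_univ j) h) (fun m => ?_) fun F B _ hB =>
      (norm_sum_le _ _).trans (hB ())
  filter_upwards [hlim.eventually_le_const (by positivity : (0 : ℝ) < (1 / 2) ^ m)] with n hn _ _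
  exact hn

end Weak

section ZeroAtInfty

variable {ι : Type*} [TopologicalSpace ι]

theorem zeroAtInfty_norm_le {f : C₀(ι, ℝ)} {C : ℝ} (hC : 0 ≤ C) :
    ‖f‖ ≤ C ↔ ∀ i, |f i| ≤ C := by
  rw [← ZeroAtInftyContinuousMap.norm_toBCF_eq_norm, BoundedContinuousFunction.norm_le hC]
  rfl

theorem zeroAtInfty_abs_apply_le (f : C₀(ι, ℝ)) (i : ι) : |f i| ≤ ‖f‖ :=
  (zeroAtInfty_norm_le (norm_nonneg f)).1 le_rfl i

/-- Evaluation at a point as a continuous linear functional on `C₀`. -/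
noncomputable def zeroAtInftyEval (i : ι) : C₀(ι, ℝ) →L[ℝ] ℝ :=
  LinearMap.mkContinuous
    { toFun := fun f => f i
      map_add' := fun _ _ => rfl
      map_smul' := fun _ _ => rfl } 1 fun f => by
    simpa using zeroAtInfty_abs_apply_le f i

@[simp]
theorem zeroAtInftyEval_apply (i : ι) (f : C₀(ι, ℝ)) : zeroAtInftyEval i f = f i := rfl

variable [DiscreteTopology ι]

theorem zeroAtInfty_finite (f : C₀(ι, ℝ)) {ε : ℝ} (hε : 0 < ε) : {i | ε ≤ |f i|}.Finite := by
  have h := zero_at_infty f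
  rw [cocompact_eq_cofinite] at h
  have h2 := h.abs.eventually_lt_const (by simpa using hε : |(0 : ℝ)| < ε)
  simpa [Filter.eventually_cofinite] using h2

theorem zeroAtInfty_finite_comp {κ : Type*} (f : C₀(ι, ℝ)) {ε : ℝ} (hε : 0 < ε) {e : κ → ι}
    (he : Function.Injective e) : {k | ε ≤ |f (e k)|}.Finite :=
  (zeroAtInfty_finite f hε).preimage (f := e) he.injOn

/-- An element of `c₀` of a discrete space, from its values. -/
def zeroAtInftyMk (f : ι → ℝ) (hf : ∀ ε > 0, {i | ε ≤ |f i|}.Finite) : C₀(ι, ℝ) where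
  toFun := f
  continuous_toFun := continuous_of_discreteTopology
  zero_at_infty' := by
    rw [cocompact_eq_cofinite, Metric.tendsto_nhds]
    intro ε hε
    simpa [Filter.eventually_cofinite] using hf ε hε

@[simp]
theorem zeroAtInftyMk_apply (f : ι → ℝ) (hf) (i : ι) : zeroAtInftyMk f hf i = f i := rfl

theorem randomIdeal_katetovLE_of_zeroAtInfty {y : ℕ → C₀(ι, ℝ)} (hy : WeaklyNull y) :
    KatetovLE randomIdeal (boundedIdeal y) := by
  obtain ⟨C, hC, hCy⟩ := hy.exists_norm_le
  -- These sets are finite, so coordinatewise convergence to zero is uniform on each of them.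
  refine randomIdeal_katetovLE_of_domination (J := ι) (fun j n => |y n j|)
    (fun n => {j | (1 / 2) ^ n ≤ |y n j|}) hC
    (fun j n => (zeroAtInfty_abs_apply_le _ _).trans (hCy n))
    (fun j n h => (not_le.1 h).le) (fun m => ?_) fun F B hB h =>
      (zeroAtInfty_norm_le hB).2 fun j => ?_
  · rw [Filter.eventually_all_finite (zeroAtInfty_finite (y m) (by positivity))]
    intro j _
    have h := (hy (zeroAtInftyEval j)).abs
    simp only [zeroAtInftyEval_apply, abs_zero] at h
    exact h.eventually_le_const (by positivity)
  · rw [← zeroAtInftyEval_apply, map_sum]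
    exact (Finset.abs_sum_le_sum_abs _ _).trans (h j)

end ZeroAtInfty

/-! ### Spaces of infinite rank carry weakly null sequences with a trivial ideal -/

theorem exists_disjoint_isOpen_of_mem_derivedSet {K : Type*} [MetricSpace K] {A U : Set K}
    {x : K} (hx : x ∈ derivedSet A) (hU : IsOpen U) (hxU : x ∈ U) :
    ∃ (p : ℕ → K) (V : ℕ → Set K), (∀ i, p i ∈ A) ∧ (∀ i, p i ∈ V i) ∧ (∀ i, IsOpen (V i)) ∧
      (∀ i, V i ⊆ U) ∧ Pairwise (Function.onFun Disjoint V) := by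
  have hstep : ∀ ρ : ℝ, 0 < ρ → ∃ y : {y : K // y ∈ A ∧ y ∈ U ∧ y ≠ x}, dist (y : K) x < ρ := by
    intro ρ hρ
    obtain ⟨y, ⟨⟨hy1, hy2⟩, hy3⟩, hy4⟩ := accPt_iff_nhds.1 hx (U ∩ Metric.ball x ρ)
      (inter_mem (hU.mem_nhds hxU) (Metric.ball_mem_nhds x hρ))
    exact ⟨⟨y, hy3, hy1, hy4⟩, hy2⟩
  have : Nonempty {y : K // y ∈ A ∧ y ∈ U ∧ y ≠ x} := ⟨(hstep 1 one_pos).choose⟩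
  choose! f hf using hstep
  have hpos : ∀ y : {y : K // y ∈ A ∧ y ∈ U ∧ y ≠ x}, 0 < dist y.1 x := fun y =>
    dist_pos.2 y.2.2.2
  obtain ⟨q, hq⟩ : ∃ q : ℕ → {y : K // y ∈ A ∧ y ∈ U ∧ y ≠ x},
      ∀ i, dist (q (i + 1)).1 x < dist (q i).1 x / 2 :=
    ⟨fun n => Nat.rec (f 1) (fun _ y => f (dist y.1 x / 2)) n, fun i => hf _ (half_pos (hpos _))⟩
  have hanti : StrictAnti fun i => dist (q i).1 x :=
    strictAnti_nat_of_succ_lt fun i => (hq i).trans (half_lt_self (hpos (q i)))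
  have hlt : ∀ i j, i < j → dist (q j).1 x < dist (q i).1 x / 2 := fun i j hij =>
    (hanti.antitone (Nat.succ_le_of_lt hij)).trans_lt (hq i)
  -- Distances to `x` more than halve at each step, and `5 / 4 * (1 / 2) < 3 / 4`, so these annuli
  -- are disjoint.
  refine ⟨fun i => (q i).1, fun i => {y | y ∈ U ∧ 3 / 4 * dist (q i).1 x < dist y x ∧
    dist y x < 5 / 4 * dist (q i).1 x}, fun i => (q i).2.1, fun i => ⟨(q i).2.2.1, ?_, ?_⟩,
    fun i => ?_, fun i y hy => hy.1, ?_⟩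
  · linarith [hpos (q i)]
  · linarith [hpos (q i)]
  · have hd : Continuous fun y => dist y x := by fun_prop
    exact hU.inter ((isOpen_lt continuous_const hd).inter (isOpen_lt hd continuous_const))
  · have key : ∀ i j, i < j → ∀ y, 3 / 4 * dist (q i).1 x < dist y x →
        dist y x < 5 / 4 * dist (q j).1 x → False := by
      intro i j hij y h1 h2
      linarith [hlt i j hij, hpos (q i)]
    intro i j hij
    refine Set.disjoint_left.2 fun y hi hj => ?_
    rcases hij.lt_or_gt with h | h
    · exact key i j h y hi.2.1 hj.2.2
    · exact key j i h y hj.2.1 hi.2.2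

/-- Functions supported in `U`, with values in `[0, 1]`, whose sum is at most `m`, and such that any
`m` of them are equal to one at a common point. -/
structure IsSpread {K : Type*} [TopologicalSpace K] (m : ℕ) (U : Set K) (h : ℕ → C(K, ℝ)) :
    Prop where
  nonneg : ∀ n y, 0 ≤ h n y
  le_one : ∀ n y, h n y ≤ 1
  eq_zero : ∀ n, ∀ y ∉ U, h n y = 0
  sum_le : ∀ (F : Finset ℕ) (y : K), ∑ n ∈ F, h n y ≤ m
  exists_eq_one : ∀ F : Finset ℕ, F.card = m → ∃ y ∈ U, ∀ n ∈ F, h n y = 1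

/-- On `V i` the new sequence is zero for `n < i`, is `b i` for `n = i`, and is `h i n` for `n > i`.
Hence its sums grow by at most one. -/
theorem IsSpread.succ {K : Type*} [TopologicalSpace K] {m : ℕ} {U : Set K} {V W : ℕ → Set K}
    (hVU : ∀ i, V i ⊆ U) (hWV : ∀ i, W i ⊆ V i) (hV : Pairwise (Function.onFun Disjoint V))
    {b : ℕ → C(K, ℝ)} (hb : ∀ i y, b i y ∈ Set.Icc (0 : ℝ) 1) (hb0 : ∀ i, ∀ y ∉ V i, b i y = 0)
    (hb1 : ∀ i, ∀ y ∈ W i, b i y = 1) {h : ℕ → ℕ → C(K, ℝ)} (hh : ∀ i, IsSpread m (W i) (h i)) :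
    IsSpread (m + 1) U fun n => b n + ∑ i ∈ Finset.range n, h i n := by
  have hout : ∀ i n, ∀ y ∉ V i, h i n y = 0 := fun i n y hy =>
    (hh i).eq_zero n y fun hW => hy (hWV i hW)
  have hval : ∀ i, ∀ y ∈ V i, ∀ n, (b n + ∑ i ∈ Finset.range n, h i n) y =
      (if n = i then b i y else 0) + if i < n then h i n y else 0 := by
    intro i y hy n
    have hne : ∀ j, j ≠ i → y ∉ V j := fun j hj hyj => Set.disjoint_left.1 (hV hj) hyj hy
    rw [ContinuousMap.add_apply, ContinuousMap.sum_apply]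
    congr 1
    · split_ifs with hn
      · rw [hn]
      · exact hb0 n y (hne n hn)
    · split_ifs with hn
      · exact Finset.sum_eq_single_of_mem i (Finset.mem_range.2 hn)
          fun j _ hj => hout j n y (hne j hj)
      · refine Finset.sum_eq_zero fun j hj => hout j n y (hne j ?_)
        rintro rfl
        exact hn (Finset.mem_range.1 hj)
  have hval0 : ∀ y, (∀ i, y ∉ V i) → ∀ n, (b n + ∑ i ∈ Finset.range n, h i n) y = 0 := by
    intro y hy n
    rw [ContinuousMap.add_apply, ContinuousMap.sum_apply, hb0 n y (hy n), zero_add]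
    exact Finset.sum_eq_zero fun j _ => hout j n y (hy j)
  refine ⟨fun n y => ?_, fun n y => ?_, fun n y hy => ?_, fun F y => ?_, fun F hF => ?_⟩
  · rw [ContinuousMap.add_apply, ContinuousMap.sum_apply]
    exact add_nonneg (hb n y).1 (Finset.sum_nonneg fun i _ => (hh i).nonneg n y)
  · by_cases hy : ∃ i, y ∈ V i
    · obtain ⟨i, hi⟩ := hy
      rw [hval i y hi n]
      have h1 := (hb i y).2
      have h2 := (hh i).le_one n y
      split_ifs with h3 h4 h4
      · exact absurd h3 h4.ne'
      · simpa using h1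
      · simpa using h2
      · simp
    · rw [hval0 y (not_exists.1 hy) n]
      exact zero_le_one
  · exact hval0 y (fun i hi => hy (hVU i hi)) n
  · by_cases hy : ∃ i, y ∈ V i
    · obtain ⟨i, hi⟩ := hy
      rw [Finset.sum_congr rfl fun n _ => hval i y hi n, Finset.sum_add_distrib,
        ← Finset.sum_filter _ fun n => h i n y, Finset.sum_ite_eq']
      have h1 := (hh i).sum_le (F.filter (i < ·)) y
      have h2 : (if i ∈ F then b i y else 0) ≤ 1 := by
        split_ifs
        · exact (hb i y).2
        · exact zero_le_one
      push_cast
      linarith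
    · rw [Finset.sum_eq_zero fun n _ => hval0 y (not_exists.1 hy) n]
      positivity
  -- The least element `i` of `F` selects the region `W i`, where `b i = 1`; the spread `h i`
  -- handles the other `m` elements.
  · have hne : F.Nonempty := Finset.card_pos.1 (by omega)
    have hmin := F.min'_mem hne
    obtain ⟨y, hyW, hy⟩ := (hh (F.min' hne)).exists_eq_one (F.erase (F.min' hne)) (by
      rw [Finset.card_erase_of_mem hmin, hF]
      rfl)
    have hyV := hWV _ hyW
    refine ⟨y, hVU _ hyV, fun n hn => ?_⟩
    rw [hval _ y hyV]
    rcases eq_or_ne n (F.min' hne) with h1 | h1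
    · simp [h1, hb1 _ y hyW]
    · have hlt : F.min' hne < n := lt_of_le_of_ne (F.min'_le n hn) h1.symm
      rw [if_neg h1, if_pos hlt, zero_add]
      exact hy n (Finset.mem_erase.2 ⟨h1, hn⟩)

theorem exists_isSpread {K : Type*} [MetricSpace K] (m : ℕ) {U : Set K}
    (hU : IsOpen U)
    (hne : (U ∩ CantorBendixson.iteratedDerivedSet (Set.univ : Set K) (m : Ordinal)).Nonempty) :
    ∃ h : ℕ → C(K, ℝ), IsSpread m U h := by
  induction m generalizing U with
  | zero =>
    obtain ⟨x, hx, -⟩ := hne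
    refine ⟨0, ⟨by simp, by simp, by simp, by simp, fun F hF => ⟨x, hx, ?_⟩⟩⟩
    rw [Finset.card_eq_zero.1 hF]
    simp
  | succ m ih =>
    obtain ⟨x, hxU, hx⟩ := hne
    rw [Nat.cast_succ, CantorBendixson.iteratedDerivedSet_succ] at hx
    obtain ⟨p, V, hpA, hpV, hV, hVU, hdisj⟩ :=
      exists_disjoint_isOpen_of_mem_derivedSet hx.1 hU hxU
    have hW : ∀ i, ∃ W : Set K, IsOpen W ∧ p i ∈ W ∧ closure W ⊆ V i := fun i => by
      obtain ⟨W, hW1, hW2, hW3⟩ := normal_exists_closure_subset (isClosed_singleton (x := p i))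
        (hV i) (Set.singleton_subset_iff.2 (hpV i))
      exact ⟨W, hW1, hW2 rfl, hW3⟩
    choose W hWo hpW hWV using hW
    have hb : ∀ i, ∃ f : C(K, ℝ), Set.EqOn f 0 (V i)ᶜ ∧ Set.EqOn f 1 (closure (W i)) ∧
        ∀ y, f y ∈ Set.Icc (0 : ℝ) 1 := fun i =>
      exists_continuous_zero_one_of_isClosed (hV i).isClosed_compl isClosed_closure
        (Set.disjoint_left.2 fun y hy hy' => hy (hWV i hy'))
    choose b hb0 hb1 hb using hb
    choose h hh using fun i => ih (hWo i) ⟨p i, hpW i, hpA i⟩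
    exact ⟨_, IsSpread.succ hVU (fun i => subset_closure.trans (hWV i)) hdisj hb
      (fun i y hy => hb0 i hy) (fun i y hy => hb1 i (subset_closure hy)) hh⟩

/-! ### Weak nullity of spreads and their superposition -/

section Compact

variable {K : Type*} [TopologicalSpace K] [CompactSpace K]

theorem IsSpread.norm_le_one {m : ℕ} {U : Set K} {h : ℕ → C(K, ℝ)} (hh : IsSpread m U h) (n : ℕ) :
    ‖h n‖ ≤ 1 := by
  rw [ContinuousMap.norm_le _ zero_le_one]
  intro y
  rw [Real.norm_of_nonneg (hh.nonneg n y)]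
  exact hh.le_one n y

/-- All signed finite sums have norm at most `m`; taking the signs of `φ (h n)` gives `∑ |φ (h n)| ≤
‖φ‖ * m`. -/
theorem IsSpread.weaklyNull {m : ℕ} {U : Set K} {h : ℕ → C(K, ℝ)} (hh : IsSpread m U h) :
    WeaklyNull h := by
  intro φ
  have hs : Summable fun n => |φ (h n)| := by
    refine summable_of_sum_le (c := ‖φ‖ * m) (fun n => abs_nonneg _) fun F => ?_
    have h1 : ∑ n ∈ F, |φ (h n)| = φ (∑ n ∈ F, (SignType.sign (φ (h n)) : ℝ) • h n) := by
      rw [map_sum]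
      refine Finset.sum_congr rfl fun n _ => ?_
      rw [map_smul, smul_eq_mul, sign_mul_self]
    rw [h1]
    refine (le_abs_self _).trans (φ.le_opNorm_of_le ?_)
    rw [ContinuousMap.norm_le _ (Nat.cast_nonneg m)]
    intro y
    rw [ContinuousMap.sum_apply]
    refine (norm_sum_le _ _).trans ((Finset.sum_le_sum fun n _ => ?_).trans (hh.sum_le F y))
    rw [ContinuousMap.smul_apply, smul_eq_mul, norm_mul, Real.norm_of_nonneg (hh.nonneg n y)]
    refine mul_le_of_le_one_left (hh.nonneg n y) ?_
    rcases SignType.trichotomy (SignType.sign (φ (h n))) with h2 | h2 | h2 <;> simp [h2]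
  exact (tendsto_zero_iff_abs_tendsto_zero _).2 hs.tendsto_atTop_zero

/-- An infinite set contains `4 ^ k` indices, and at their common point the `k`-th layer alone sums
to `4 ^ k * 2 ^ (-k) = 2 ^ k`. Weak nullity passes to the series by dominated convergence. -/
theorem exists_weaklyNull_boundedIdeal_subset_finIdeal {h : ℕ → ℕ → C(K, ℝ)}
    (hh : ∀ k, IsSpread (4 ^ k) Set.univ (h k)) :
    ∃ g : ℕ → C(K, ℝ), WeaklyNull g ∧ boundedIdeal g ⊆ finIdeal := by
  have hnorm : ∀ k n, ‖(1 / 2 : ℝ) ^ k • h k n‖ ≤ (1 / 2) ^ k := fun k n => by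
    rw [norm_smul, Real.norm_of_nonneg (by positivity)]
    exact mul_le_of_le_one_right (by positivity) ((hh k).norm_le_one n)
  have hsum : ∀ n, Summable fun k => (1 / 2 : ℝ) ^ k • h k n := fun n =>
    Summable.of_norm_bounded summable_geometric_two fun k => hnorm k n
  have hle : ∀ k n y, (1 / 2 : ℝ) ^ k * h k n y ≤ (∑' k, (1 / 2 : ℝ) ^ k • h k n) y := by
    intro k n y
    have h1 : HasSum (fun k => (1 / 2 : ℝ) ^ k * h k n y)
        ((∑' k, (1 / 2 : ℝ) ^ k • h k n) y) := ContinuousMap.hasSum_apply (hsum n).hasSum y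
    exact le_hasSum h1 k fun j _ => mul_nonneg (by positivity) ((hh j).nonneg n y)
  refine ⟨fun n => ∑' k, (1 / 2 : ℝ) ^ k • h k n, fun φ => ?_, ?_⟩
  · simp only [φ.map_tsum (hsum _)]
    refine (tendsto_tsum_of_dominated_convergence (bound := fun k => ‖φ‖ * (1 / 2) ^ k)
      (summable_geometric_two.mul_left _) (fun k => ?_)
      (Eventually.of_forall fun n k => φ.le_opNorm_of_le (hnorm k n))).trans_eq
      (by rw [tsum_zero])
    simpa using ((hh k).weaklyNull φ).const_mul ((1 / 2 : ℝ) ^ k)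
  · rintro M ⟨C, hC⟩
    by_contra hM
    obtain ⟨k, hk⟩ := pow_unbounded_of_one_lt C (one_lt_two : (1 : ℝ) < 2)
    obtain ⟨F, hFM, hF⟩ := Set.Infinite.exists_subset_card_eq hM (4 ^ k)
    obtain ⟨y, -, hy⟩ := (hh k).exists_eq_one F hF
    have h1 : (2 : ℝ) ^ k ≤ (∑ n ∈ F, ∑' k, (1 / 2 : ℝ) ^ k • h k n) y := by
      rw [ContinuousMap.sum_apply]
      calc (2 : ℝ) ^ k = ∑ n ∈ F, (1 / 2 : ℝ) ^ k * h k n y := by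
            rw [Finset.sum_congr rfl fun n hn => by rw [hy n hn], Finset.sum_const, hF,
              nsmul_eq_mul]
            push_cast
            rw [mul_one, ← mul_pow]
            norm_num
        _ ≤ _ := Finset.sum_le_sum fun n _ => hle k n y
    have h2 := (le_abs_self _).trans (ContinuousMap.norm_coe_le_norm
      (∑ n ∈ F, ∑' k, (1 / 2 : ℝ) ^ k • h k n) y)
    linarith [hC F hFM]

theorem finiteCBRank_of_finIdeal_ssubset [MetrizableSpace K]
    (hK : ∀ g : ℕ → C(K, ℝ), WeaklyNull g → finIdeal ⊂ boundedIdeal g) : FiniteCBRank K := by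
  let := metrizableSpaceMetric K
  by_contra hrank
  have hne : ∀ m : ℕ, (Set.univ ∩ CantorBendixson.iteratedDerivedSet (Set.univ : Set K)
      (m : Ordinal)).Nonempty := fun m => by
    rw [Set.univ_inter, Set.nonempty_iff_ne_empty]
    exact fun h => hrank ⟨m, h⟩
  choose h hh using fun k : ℕ => exists_isSpread (4 ^ k) isOpen_univ (hne (4 ^ k))
  obtain ⟨g, hg, hsub⟩ := exists_weaklyNull_boundedIdeal_subset_finIdeal hh
  exact (hK g hg).2 hsub

end Compact

/-! ### Spaces of finite rank -/

/-- The induction on rank must peel off the first derivative, whereas `iteratedDerivedSet_succ`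
peels off the last. -/
theorem iteratedDerivedSet_nat_succ {K : Type*} [TopologicalSpace K] (s : Set K) (n : ℕ) :
    CantorBendixson.iteratedDerivedSet s ((n + 1 : ℕ) : Ordinal) =
      CantorBendixson.iteratedDerivedSet (relDerivedSet s) (n : Ordinal) := by
  induction n with
  | zero =>
    rw [Nat.cast_succ, CantorBendixson.iteratedDerivedSet_succ]
    simp
  | succ n ih =>
    rw [Nat.cast_succ, CantorBendixson.iteratedDerivedSet_succ, ih, Nat.cast_succ n,
      CantorBendixson.iteratedDerivedSet_succ]

theorem nhds_eq_pure_of_notMem_derivedSet {K : Type*} [TopologicalSpace K] {s : Set K} {x : s}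
    (hx : (x : K) ∉ derivedSet s) : 𝓝 x = pure x := by
  rw [← isOpen_singleton_iff_nhds_eq_pure, isOpen_induced_iff]
  have h1 : ¬ AccPt (x : K) (𝓟 s) := hx
  rw [accPt_iff_nhds] at h1
  push Not at h1
  obtain ⟨U, hU, hUx⟩ := h1
  obtain ⟨V, hVU, hV, hxV⟩ := mem_nhds_iff.1 hU
  refine ⟨V, hV, ?_⟩
  ext y
  constructor
  · intro hy
    exact Subtype.ext (hUx y ⟨hVU hy, y.2⟩)
  · rintro rfl
    exact hxV

/-- The nearest-point map onto the derived set is a retraction, which yields a linear extension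
operator. -/
theorem exists_extension_of_derivedSet {K : Type*} [MetricSpace K] [CompactSpace K] (s : Set K) :
    ∃ E : C(derivedSet s, ℝ) →ₗ[ℝ] C(s, ℝ), (∀ h (x : s) (hx : (x : K) ∈ derivedSet s),
      E h x = h ⟨x, hx⟩) ∧ ∀ h C, (∀ y, |h y| ≤ C) → 0 ≤ C → ∀ x, |E h x| ≤ C := by
  rcases (derivedSet s).eq_empty_or_nonempty with he | hne
  · refine ⟨0, fun h x hx => ?_, fun h C _ hC x => by simpa using hC⟩
    rw [he] at hx
    exact hx.elim
  · have hcomp : IsCompact (derivedSet s) := (isClosed_derivedSet s).isCompact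
    choose r hr hdist using fun x : K => hcomp.exists_infDist_eq_dist hne x
    have hmin : ∀ x, ∀ y ∈ derivedSet s, dist x (r x) ≤ dist x y := fun x y hy =>
      (hdist x).symm.le.trans (Metric.infDist_le_dist_of_mem hy)
    have hfix : ∀ x ∈ derivedSet s, r x = x := fun x hx => by
      have := hmin x x hx
      rw [dist_self] at this
      exact (dist_le_zero.1 this).symm
    let ρ : s → derivedSet s := fun x => ⟨r x, hr x⟩
    have hρ : Continuous ρ := by
      rw [continuous_iff_continuousAt]
      intro x
      by_cases hx : (x : K) ∈ derivedSet s
      · rw [Metric.continuousAt_iff]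
        intro ε hε
        refine ⟨ε / 2, half_pos hε, fun {y} hy => ?_⟩
        change dist (r y) (r x) < ε
        rw [hfix x hx]
        have h1 := hmin y x hx
        have h2 : dist (y : K) x < ε / 2 := hy
        have h3 := dist_triangle_left (r y) (x : K) (y : K)
        linarith
      -- Nearest points may be chosen arbitrarily here, since `x` is isolated in `s`.
      · rw [ContinuousAt, nhds_eq_pure_of_notMem_derivedSet hx]
        exact tendsto_pure_left.2 fun s hs => mem_of_mem_nhds hs
    refine ⟨{ toFun := fun h => h.comp ⟨ρ, hρ⟩
              map_add' := fun _ _ => rfl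
              map_smul' := fun _ _ => rfl }, fun h x hx => ?_, fun h C hC _ x => hC _⟩
    change h ⟨r x, hr x⟩ = h ⟨x, hx⟩
    congr
    exact hfix x hx

theorem finite_of_disjoint_derivedSet {K : Type*} [MetricSpace K] [CompactSpace K] {s A : Set K}
    (hA : IsClosed A) (hAs : A ⊆ s) (hd : Disjoint A (derivedSet s)) : A.Finite := by
  by_contra hinf
  obtain ⟨x, hx, hacc⟩ := Set.Infinite.exists_accPt_of_subset_isCompact hinf hA.isCompact subset_rfl
  exact Set.disjoint_left.1 hd hx (hacc.mono (principal_mono.2 hAs))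

theorem discreteTopology_diff_derivedSet {K : Type*} [TopologicalSpace K] (s : Set K) :
    DiscreteTopology (s \ derivedSet s : Set K) := by
  rw [discreteTopology_subtype_iff]
  intro x hx
  have h1 : ¬ AccPt x (𝓟 s) := hx.2
  rw [AccPt, not_neBot] at h1
  exact le_bot_iff.1 (h1 ▸ inf_le_inf_left _ (principal_mono.2 Set.sdiff_subset))

theorem continuous_extend_zeroAtInfty {K : Type*} [MetricSpace K] {s : Set K}
    [DecidablePred (· ∈ derivedSet s)] {c : (s \ derivedSet s : Set K) → ℝ}
    (hc : ∀ ε > 0, {d | ε ≤ |c d|}.Finite) :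
    Continuous fun x : s => if hx : (x : K) ∈ derivedSet s then 0 else c ⟨x, x.2, hx⟩ := by
  rw [continuous_iff_continuousAt]
  intro x
  by_cases hx : (x : K) ∈ derivedSet s
  · rw [Metric.continuousAt_iff']
    intro ε hε
    have hfin : ((fun d : (s \ derivedSet s : Set K) => (⟨d, d.2.1⟩ : s)) ''
      {d | ε ≤ |c d|}).Finite := (hc ε hε).image _
    have hmem : x ∉ (fun d : (s \ derivedSet s : Set K) => (⟨d, d.2.1⟩ : s)) ''
        {d | ε ≤ |c d|} := by
      rintro ⟨d, -, rfl⟩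
      exact d.2.2 hx
    filter_upwards [hfin.isClosed.isOpen_compl.mem_nhds hmem] with y hy
    rw [dif_pos hx, Real.dist_eq, sub_zero]
    split_ifs with hy'
    · simpa using hε
    · by_contra hle
      exact hy ⟨⟨y, y.2, hy'⟩, not_lt.1 hle, rfl⟩
  · rw [ContinuousAt, nhds_eq_pure_of_notMem_derivedSet hx]
    exact tendsto_pure_left.2 fun s hs => mem_of_mem_nhds hs

/-- With `R` the restriction to the derived set, `f` corresponds to the pair `(T (R f), f - E (R
f))`. The second entry vanishes on the derived set, so by compactness it exceeds each `ε > 0` at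
only finitely many isolated points. -/
theorem nonempty_zeroAtInfty_equiv_of_derivedSet {K : Type*} [MetricSpace K] [CompactSpace K]
    {s : Set K} (hs : IsClosed s) [CompactSpace s] [CompactSpace (derivedSet s)] {ι : Type*}
    [TopologicalSpace ι] [DiscreteTopology ι] [DiscreteTopology (s \ derivedSet s : Set K)]
    (T : C(derivedSet s, ℝ) ≃L[ℝ] C₀(ι, ℝ)) :
    Nonempty (C(s, ℝ) ≃L[ℝ] C₀(ι ⊕ (s \ derivedSet s : Set K), ℝ)) := by
  classical
  obtain ⟨E, hE, hEnorm⟩ := exists_extension_of_derivedSet s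
  have hsub : derivedSet s ⊆ s := (isClosed_iff_derivedSet_subset s).1 hs
  let R : C(s, ℝ) →ₗ[ℝ] C(derivedSet s, ℝ) :=
    { toFun := fun f => f.comp ⟨Set.inclusion hsub, continuous_inclusion hsub⟩
      map_add' := fun _ _ => rfl
      map_smul' := fun _ _ => rfl }
  have hR : ∀ f (y : derivedSet s), R f y = f ⟨y, hsub y.2⟩ := fun _ _ => rfl
  have hRnorm : ∀ f, ‖R f‖ ≤ ‖f‖ := fun f =>
    (ContinuousMap.norm_le _ (norm_nonneg f)).2 fun y => f.norm_coe_le_norm _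
  let v : C(s, ℝ) → ι ⊕ (s \ derivedSet s : Set K) → ℝ := fun f =>
    Sum.elim (fun i => T (R f) i) fun d => f ⟨d, d.2.1⟩ - E (R f) ⟨d, d.2.1⟩
  have hv : ∀ f, ∀ ε > 0, {i | ε ≤ |v f i|}.Finite := by
    intro f ε hε
    let A : Set s := {x | ε ≤ |f x - E (R f) x|}
    have hA : IsClosed A := isClosed_le continuous_const (by fun_prop)
    have hAfin : (Subtype.val '' A).Finite := by
      refine finite_of_disjoint_derivedSet (s := s)
        (hA.isCompact.image continuous_subtype_val).isClosed ?_ ?_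
      · rintro _ ⟨x, -, rfl⟩
        exact x.2
      · refine Set.disjoint_left.2 ?_
        rintro _ ⟨x, hx, rfl⟩ hx'
        have h1 : ε ≤ |f x - E (R f) x| := hx
        rw [hE _ x hx', hR, sub_self, abs_zero] at h1
        exact absurd hε h1.not_gt
    refine (((zeroAtInfty_finite (T (R f)) hε).image Sum.inl).union
      ((hAfin.preimage Subtype.val_injective.injOn).image Sum.inr)).subset ?_
    rintro (i | d) hi
    · exact Or.inl ⟨i, hi, rfl⟩
    · exact Or.inr ⟨d, ⟨⟨d, d.2.1⟩, hi, rfl⟩, rfl⟩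
  let Φ : C(s, ℝ) →ₗ[ℝ] C₀(ι ⊕ (s \ derivedSet s : Set K), ℝ) :=
    { toFun := fun f => zeroAtInftyMk (v f) (hv f)
      map_add' := fun f g => by
        ext i
        rcases i with i | d
        · simp [v]
        · simp [v]
          ring
      map_smul' := fun a f => by
        ext i
        rcases i with i | d
        · simp [v]
        · simp [v]
          ring }
  have hΦ : ∀ f i, Φ f i = v f i := fun _ _ => rfl
  let Ψ := Φ.mkContinuous (‖(T : C(derivedSet s, ℝ) →L[ℝ] C₀(ι, ℝ))‖ + 2) (fun f => by
    refine (zeroAtInfty_norm_le (by positivity)).2 ?_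
    rintro (i | d)
    · refine (zeroAtInfty_abs_apply_le (T (R f)) i).trans ?_
      refine ((T : C(derivedSet s, ℝ) →L[ℝ] C₀(ι, ℝ)).le_opNorm_of_le (hRnorm f)).trans ?_
      gcongr
      linarith
    · have h1 : |f ⟨d, d.2.1⟩| ≤ ‖f‖ := f.norm_coe_le_norm _
      have h2 : |E (R f) ⟨d, d.2.1⟩| ≤ ‖f‖ :=
        hEnorm (R f) ‖f‖ (fun y => f.norm_coe_le_norm _) (norm_nonneg f) _
      have h3 := abs_sub (f ⟨d, d.2.1⟩) (E (R f) ⟨d, d.2.1⟩)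
      have h4 : 0 ≤ ‖(T : C(derivedSet s, ℝ) →L[ℝ] C₀(ι, ℝ))‖ * ‖f‖ := by positivity
      change |f ⟨d, d.2.1⟩ - E (R f) ⟨d, d.2.1⟩| ≤ _
      linarith)
  -- The open mapping theorem supplies the continuity of the inverse.
  refine ⟨ContinuousLinearEquiv.ofBijective Ψ ?_ ?_⟩
  · refine LinearMap.ker_eq_bot'.2 fun f hf => ?_
    have hf' : ∀ i, v f i = 0 := fun i => by
      rw [← hΦ]
      exact DFunLike.congr_fun (hf : Φ f = 0) i
    have h1 : T (R f) = 0 := by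
      ext i
      exact hf' (Sum.inl i)
    have h2 : R f = 0 := by simpa using h1
    ext x
    by_cases hx : (x : K) ∈ derivedSet s
    · rw [← hR f ⟨x, hx⟩, h2]
      rfl
    · have h3 : f x - E (R f) x = 0 := hf' (Sum.inr ⟨x, x.2, hx⟩)
      rw [h2, map_zero] at h3
      simpa using h3
  · refine LinearMap.range_eq_top.2 fun c => ?_
    have hcl : ∀ ε > 0, {i | ε ≤ |c (Sum.inl i)|}.Finite := fun ε hε =>
      zeroAtInfty_finite_comp c hε Sum.inl_injective
    have hcr : ∀ ε > 0, {i | ε ≤ |c (Sum.inr i)|}.Finite := fun ε hε =>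
      zeroAtInfty_finite_comp c hε Sum.inr_injective
    let h := T.symm (zeroAtInftyMk _ hcl)
    let f : C(s, ℝ) := E h + ⟨_, continuous_extend_zeroAtInfty hcr⟩
    have hf : ∀ x : s, f x = E h x +
      if hx : (x : K) ∈ derivedSet s then 0 else c (Sum.inr ⟨x, x.2, hx⟩) := fun _ => rfl
    have hRf : R f = h := by
      ext y
      rw [hR, hf, dif_pos y.2, add_zero]
      exact hE h _ y.2
    refine ⟨f, ?_⟩
    ext i
    change v f i = c i
    rcases i with i | d
    · change T (R f) i = _
      rw [hRf, T.apply_symm_apply]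
      rfl
    · change f ⟨d, d.2.1⟩ - E (R f) ⟨d, d.2.1⟩ = _
      rw [hRf, hf, dif_neg d.2.2]
      simp

universe u

theorem exists_zeroAtInfty_equiv_of_iteratedDerivedSet_eq_empty {K : Type u} [MetricSpace K]
    [CompactSpace K] (n : ℕ) {s : Set K} (hs : IsClosed s) [CompactSpace s]
    (hn : CantorBendixson.iteratedDerivedSet s (n : Ordinal) = ∅) :
    ∃ (ι : Type u) (_ : Countable ι) (_ : TopologicalSpace ι) (_ : DiscreteTopology ι),
      Nonempty (C(s, ℝ) ≃L[ℝ] C₀(ι, ℝ)) := by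
  induction n generalizing s with
  | zero =>
    rw [Nat.cast_zero, CantorBendixson.iteratedDerivedSet_zero] at hn
    have : IsEmpty s := Set.isEmpty_coe_sort.2 hn
    have : Subsingleton C(s, ℝ) := ⟨fun f g => by ext x; exact isEmptyElim x⟩
    have : Subsingleton C₀(PEmpty.{u + 1}, ℝ) := ⟨fun f g => by ext x; exact x.elim⟩
    exact ⟨PEmpty, inferInstance, ⊥, ⟨rfl⟩, ⟨0, 0, fun _ => Subsingleton.elim _ _,
      fun _ => Subsingleton.elim _ _⟩, by fun_prop, by fun_prop⟩
  | succ n ih =>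
    have hd : IsClosed (derivedSet s) := isClosed_derivedSet s
    have : CompactSpace (derivedSet s) := isCompact_iff_compactSpace.1 hd.isCompact
    have := discreteTopology_diff_derivedSet s
    rw [iteratedDerivedSet_nat_succ, hs.relDerivedSet_eq] at hn
    obtain ⟨ι, h1, h2, h3, ⟨T⟩⟩ := ih hd hn
    -- Countability is what later allows reindexing by `ℕ`.
    have : Countable (s \ derivedSet s : Set K) := countable_of_Lindelof_of_discrete
    exact ⟨_, inferInstance, inferInstance, inferInstance,
      nonempty_zeroAtInfty_equiv_of_derivedSet hs T⟩

theorem finiteDimensional_zeroAtInfty (ι : Type*) [TopologicalSpace ι] [Finite ι] :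
    FiniteDimensional ℝ C₀(ι, ℝ) := by
  let T : C₀(ι, ℝ) →ₗ[ℝ] ι → ℝ :=
    { toFun := fun f => f
      map_add' := fun _ _ => rfl
      map_smul' := fun _ _ => rfl }
  exact FiniteDimensional.of_injective T DFunLike.coe_injective

/-- Reindexing as a linear isomorphism of `c₀` spaces. -/
noncomputable def zeroAtInftyCongr {ι κ : Type*} [TopologicalSpace ι] [DiscreteTopology ι]
    [TopologicalSpace κ] [DiscreteTopology κ] (e : ι ≃ κ) : C₀(ι, ℝ) ≃L[ℝ] C₀(κ, ℝ) :=
  LinearIsometryEquiv.toContinuousLinearEquiv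
    { toFun := fun f => zeroAtInftyMk (fun k => f (e.symm k)) fun ε hε =>
        zeroAtInfty_finite_comp f hε e.symm.injective
      invFun := fun f => zeroAtInftyMk (fun i => f (e i)) fun ε hε =>
        zeroAtInfty_finite_comp f hε e.injective
      left_inv := fun f => by ext; simp
      right_inv := fun f => by ext; simp
      map_add' := fun _ _ => rfl
      map_smul' := fun _ _ => rfl
      norm_map' := fun f => by
        refine le_antisymm ((zeroAtInfty_norm_le (norm_nonneg _)).2 fun k =>
          zeroAtInfty_abs_apply_le f _) ((zeroAtInfty_norm_le (norm_nonneg _)).2 fun i => ?_)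
        refine le_of_eq_of_le ?_ (zeroAtInfty_abs_apply_le _ (e i))
        exact congrArg (fun j => |f j|) (e.symm_apply_apply i).symm }

theorem finiteDimensional_or_equiv_zeroAtInfty {K : Type*} [TopologicalSpace K] [CompactSpace K]
    [MetrizableSpace K] (hK : FiniteCBRank K) :
    FiniteDimensional ℝ C(K, ℝ) ∨ Nonempty (C(K, ℝ) ≃L[ℝ] C₀(ℕ, ℝ)) := by
  let := metrizableSpaceMetric K
  obtain ⟨n, hn⟩ := hK
  have := isCompact_iff_compactSpace.1 (isCompact_univ (X := K))
  obtain ⟨ι, h1, h2, h3, ⟨T⟩⟩ :=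
    exists_zeroAtInfty_equiv_of_iteratedDerivedSet_eq_empty n isClosed_univ hn
  let e := Homeomorph.Set.univ K
  let R : C(K, ℝ) ≃L[ℝ] C((Set.univ : Set K), ℝ) :=
    { toFun := fun f => f.comp e
      invFun := fun f => f.comp e.symm
      left_inv := fun _ => rfl
      right_inv := fun _ => rfl
      map_add' := fun _ _ => rfl
      map_smul' := fun _ _ => rfl
      continuous_toFun := ContinuousMap.continuous_precomp _
      continuous_invFun := ContinuousMap.continuous_precomp _ }
  let T' := R.trans T
  rcases finite_or_infinite ι with h | h
  · have := finiteDimensional_zeroAtInfty ι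
    exact Or.inl (T'.symm.toLinearEquiv.finiteDimensional)
  · obtain ⟨_⟩ := nonempty_denumerable ι
    exact Or.inr ⟨T'.trans (zeroAtInftyCongr (Denumerable.eqv ι))⟩

end BIdeal

theorem mainTheorem12 (K : Type*) [TopologicalSpace K] [CompactSpace K] [MetrizableSpace K] :
    List.TFAE [
      ∀ g : ℕ → C(K, ℝ), BIdeal.WeaklyNull g → BIdeal.Tall (BIdeal.boundedIdeal g),
      ∀ g : ℕ → C(K, ℝ), BIdeal.WeaklyNull g → BIdeal.finIdeal ⊂ BIdeal.boundedIdeal g,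
      ∀ g : ℕ → C(K, ℝ), BIdeal.WeaklyNull g →
        BIdeal.KatetovLE BIdeal.randomIdeal (BIdeal.boundedIdeal g),
      BIdeal.FiniteCBRank K,
      FiniteDimensional ℝ C(K, ℝ) ∨ Nonempty (C(K, ℝ) ≃L[ℝ] C₀(ℕ, ℝ))] := by
  tfae_have 3 → 1 := fun h g hg => BIdeal.tall_of_randomIdeal_katetovLE (h g hg)
  tfae_have 1 → 2 := fun h g hg => BIdeal.finIdeal_ssubset_boundedIdeal_of_tall (h g hg)
  tfae_have 2 → 4 := BIdeal.finiteCBRank_of_finIdeal_ssubset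
  tfae_have 4 → 5 := BIdeal.finiteDimensional_or_equiv_zeroAtInfty
  tfae_have 5 → 3 := by
    rintro (h | ⟨⟨T⟩⟩) g hg
    · exact BIdeal.randomIdeal_katetovLE_of_finiteDimensional hg
    · obtain ⟨f, hf⟩ := BIdeal.randomIdeal_katetovLE_of_zeroAtInfty
        (hg.map (T : C(K, ℝ) →L[ℝ] C₀(ℕ, ℝ)))
      exact ⟨f, fun A hA => BIdeal.boundedIdeal_map_subset T (hf A hA)⟩
  tfae_finish
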